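/- **Conventions.** For integers $n,k>0$ and $m\ge 0$, $\mathsf{matr}(n,m,k)$ is the set of $n\times m$ matrices with entries in $\{0,\dots,k-1\}$; such a matrix is *empty* if $m=0$. A *matrix set* is a set $S$ of such matrices (of possibly varying sizes). In a category $\mathbb C$, an *internal $n$-ary relation on an object $A$* is a jointly monic family $r_1,\dots,r_n\colon R\to A$. For $M=[a_{ij}]\in\mathsf{matr}(n,m,k)$ and an object $X$, such a relation is *$M$-closed over $X$* if for every function $f\colon\{0,\dots,k-1\}\to\mathbb C(X,A)$ the following holds: if for each $j\in\{1,\dots,m\}$ there is $u_j\colon X\to R$ with $f(a_{ij})=r_iu_j$ for all $i$, then there is $v\colon X\to R$ with $f(0)=r_iv$ for all $i$. The category $\mathbb C$ *has $M$-closed relations* if every internal $n$-ary relation on every object of $\mathbb C$ is $M$-closed over every object of $\mathbb C$. Let $\mathsf{mclex}S$ be the collection of all left exact (i.e. finitely complete) categories that have $M$-closed relations for every $M\in S$. An object $X$ of $\mathbb C$ is *$S$-injective* if for every $M\in S$, with $n$ rows say, every internal $n$-ary relation on every object of $\mathbb C^{\mathsf{op}}$ is $M$-closed over $X$; $\mathsf{Inj}_S\mathbb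 C$ is the full subcategory of $S$-injective objects. For $n>0$, $\mathbf{Rel}_n$ is the category whose objects are pairs $(X,R)$ with $X$ a set and $R\subseteq X^n$, and whose morphisms are the relation-preserving functions. **Theorem.** Let $S$ be a matrix set which contains no empty matrix and let $N\in\mathsf{matr}(n,m,k)$, where $n,k>0$ and $m\ge 0$. Then the category $(\mathsf{Inj}_S\mathbf{Rel}_n)^{\mathsf{op}}$ belongs to $\mathsf{mclex}S$, and the following statements are equivalent: 1. $\mathsf{mclex}S\subseteq\mathsf{mclex}\{N\}$; 2. $(\mathsf{Inj}_S\mathbf{Rel}_n)^{\mathsf{op}}$ belongs to $\mathsf{mclex}\{N\}$. -/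

import Mathlib

open CategoryTheory

universe w v u

namespace MatrixClass

/-- A matrix with `rows > 0` rows and `cols ≥ 0` columns, whose entries lie in
`{0, …, bound - 1}`, where `bound > 0`.  A matrix set is a `Set IntMatrix`. -/
structure IntMatrix where
  rows : ℕ
  cols : ℕ
  bound : ℕ
  rows_pos : 0 < rows
  bound_pos : 0 < bound
  entry : Matrix (Fin rows) (Fin cols) (Fin bound)

/-- The entry `0 ∈ {0, …, bound - 1}`. -/
def IntMatrix.zero (M : IntMatrix) : Fin M.bound := ⟨0, M.bound_pos⟩

/-- A matrix is empty when it has no columns. -/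
def IntMatrix.IsEmpty (M : IntMatrix) : Prop := M.cols = 0

section

variable {C : Type u} [Category.{v} C]

/-- The morphisms `r 0, …, r (n-1) : R ⟶ A i` are jointly monic, that is, they form an internal
`n`-ary relation between the objects `A 0, …, A (n-1)`. -/
def IsInternalRelation {n : ℕ} {R : C} {A : Fin n → C} (r : ∀ i, R ⟶ A i) : Prop :=
  ∀ ⦃X : C⦄ (x y : X ⟶ R), (∀ i, x ≫ r i = y ≫ r i) → x = y

/-- The family `r` is compatible with the extended matrix with left part `B` and right column `y`:
if each left column factors through `r`, then so does the right column. -/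
def IsCompatible {n m : ℕ} {R X : C} {A : Fin n → C} (r : ∀ i, R ⟶ A i)
    (B : ∀ i, Fin m → (X ⟶ A i)) (y : ∀ i, X ⟶ A i) : Prop :=
  (∀ j, ∃ g : X ⟶ R, ∀ i, B i j = g ≫ r i) → ∃ g : X ⟶ R, ∀ i, y i = g ≫ r i

/-- The relation `r` on the object `A` is (non-strictly) `M`-closed over `X`: it is compatible with
every interpretation of `M` of type `X ⟶ A`, given by one function `f` used for all the rows. -/
def IsClosedOver (M : IntMatrix) {R A : C} (r : Fin M.rows → (R ⟶ A)) (X : C) : Prop :=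
  ∀ f : Fin M.bound → (X ⟶ A),
    IsCompatible (A := fun _ => A) r (fun i j => f (M.entry i j)) (fun _ => f M.zero)

variable (C) in
/-- The category `C` has `M`-closed relations. -/
def HasClosedRelations (M : IntMatrix) : Prop :=
  ∀ ⦃R A : C⦄ (r : Fin M.rows → (R ⟶ A)), IsInternalRelation (A := fun _ => A) r →
    ∀ X : C, IsClosedOver M r X

variable (C) in
/-- The `S`-injective objects of `C`: those objects `X` such that, for every `M ∈ S`, every
internal relation (with as many components as `M` has rows) on any object of the dual category
`Cᵒᵖ` is `M`-closed over `X`. -/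
def injectiveObjects (S : Set IntMatrix) : ObjectProperty C := fun X =>
  ∀ M ∈ S, ∀ ⦃R A : Cᵒᵖ⦄ (r : Fin M.rows → (R ⟶ A)), IsInternalRelation (A := fun _ => A) r →
    IsClosedOver M r (Opposite.op X)

end

/-- The collection of all left exact (finitely complete) categories that have `M`-closed relations
for every `M ∈ S`. -/
def mclex (S : Set IntMatrix) : Set Cat.{v, u} :=
  {C | Limits.HasFiniteLimits C ∧ ∀ M ∈ S, HasClosedRelations C M}

/-- A set with an `n`-ary relation on it. -/
structure RelObj (n : ℕ) where
  carrier : Type w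
  rel : Set (Fin n → carrier)

/-- Relation-preserving functions. -/
@[ext]
structure RelObj.Hom {n : ℕ} (X Y : RelObj.{w} n) where
  toFun : X.carrier → Y.carrier
  map_rel : ∀ a ∈ X.rel, (fun i => toFun (a i)) ∈ Y.rel

/-- The category of sets with an `n`-ary relation. -/
instance (n : ℕ) : Category.{w} (RelObj.{w} n) where
  Hom X Y := RelObj.Hom X Y
  id _ := ⟨fun x => x, fun _ ha => ha⟩
  comp f g := ⟨fun x => g.toFun (f.toFun x), fun a ha => g.map_rel _ (f.map_rel a ha)⟩

/-- The full subcategory of `S`-injective objects of the category of sets with an `n`-ary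
relation. -/
abbrev InjRel (S : Set IntMatrix) (n : ℕ) : Type (w + 1) :=
  (injectiveObjects (RelObj.{w} n) S).FullSubcategory

/-- The dual of the category of `S`-injective sets with an `n`-ary relation. -/
def dualInjRel (S : Set IntMatrix) (n : ℕ) : Cat.{w, w + 1} := Cat.of (InjRel.{w} S n)ᵒᵖ

end MatrixClass

/-! An internal relation in the dual of `RelObj n` is a jointly surjective family. Testing against a
generic one shows that `Y` is `S`-injective iff it satisfies the elementary condition `Respects` for
all `M ∈ S` (`injectiveObjects_iff`). That condition passes to joint images, which gives colimits of
injective objects. For `C` in `mclex S` and a relation `r` on `A`, each `homRel r X` respects `S`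
(`homRel_respects`). A failure of `N` for `r` concerns finitely many elements of it. They span a
small injective object, where closedness in the dual category applies
(`RelObj.Respects.zero_mem_rel`). -/

namespace MatrixClass

open CategoryTheory.Limits

/-! ### An elementary form of injectivity, and its stability under joint images -/

section Respects

variable {n : ℕ}

/-- `Y` respects `M` when the partial operation on `Y` that sends `y ∘ M i` (for any row `M i` of
`M` and any valuation `y`) to `y 0` is well defined and preserves the relation of `Y`. -/
def RelObj.Respects (M : IntMatrix) (Y : RelObj.{w} n) : Prop :=
  (∀ (p q : Fin M.rows) (y z : Fin M.bound → Y.carrier),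
    (∀ j, y (M.entry p j) = z (M.entry q j)) → y M.zero = z M.zero) ∧
  ∀ (p : Fin n → Fin M.rows) (y : Fin n → Fin M.bound → Y.carrier),
    (∀ j, (fun s => y s (M.entry (p s) j)) ∈ Y.rel) → (fun s => y s M.zero) ∈ Y.rel

/-- The identification of the points of `Z` that no member of the family `g` separates. -/
def kernelSetoid {Z : Type w} {ι : Type u} {P : ι → Type v} (g : ∀ c, Z → P c) : Setoid Z where
  r x y := ∀ c, g c x = g c y
  iseqv := ⟨fun _ _ => rfl, fun h c => (h c).symm, fun h h' c => (h c).trans (h' c)⟩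

/-- The map induced by `g c` on the quotient by the common kernel of the family `g`. -/
def kernelDesc {Z : Type w} {ι : Type u} {P : ι → Type v} (g : ∀ c, Z → P c) (c : ι) :
    Quotient (kernelSetoid g) → P c :=
  Quotient.lift (g c) fun _ _ h => h c

/-- The joint image of the family `g`, with the largest relation preserved by all the `g c`. -/
def RelObj.induced {Z : Type w} {ι : Type u} (P : ι → RelObj.{v} n)
    (g : ∀ c, Z → (P c).carrier) : RelObj.{w} n where
  carrier := Quotient (kernelSetoid g)
  rel := {t | ∀ c, (fun s => kernelDesc g c (t s)) ∈ (P c).rel}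

theorem kernelDesc_ext {Z : Type w} {ι : Type u} {P : ι → Type v} {g : ∀ c, Z → P c}
    {x y : Quotient (kernelSetoid g)} (h : ∀ c, kernelDesc g c x = kernelDesc g c y) : x = y := by
  induction x using Quotient.inductionOn
  induction y using Quotient.inductionOn
  exact Quotient.sound h

/-- The maps `kernelDesc g c` jointly separate points and jointly reflect the relation, so both
conditions are checked componentwise. -/
theorem RelObj.Respects.induced {M : IntMatrix} {Z : Type w} {ι : Type u} {P : ι → RelObj.{v} n}
    (hP : ∀ c, (P c).Respects M) (g : ∀ c, Z → (P c).carrier) :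
    (RelObj.induced P g).Respects M :=
  ⟨fun p q y z h => kernelDesc_ext fun c =>
      (hP c).1 p q (fun l => kernelDesc g c (y l)) (fun l => kernelDesc g c (z l))
        fun j => congrArg (kernelDesc g c) (h j),
    fun p y h c => (hP c).2 p (fun s l => kernelDesc g c (y s l)) fun j => h j c⟩

theorem RelObj.Respects.of_rel_eq_univ {M : IntMatrix} {Y : RelObj.{w} n} (hY : Y.Respects M) :
    RelObj.Respects M (n := n) ⟨Y.carrier, Set.univ⟩ :=
  ⟨hY.1, fun _ _ _ => Set.mem_univ _⟩

theorem RelObj.respects_point {M : IntMatrix} (hM : ¬ M.IsEmpty) :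
    RelObj.Respects M (n := n) ⟨PUnit.{w + 1}, ∅⟩ :=
  ⟨fun _ _ _ _ _ => rfl, fun _ _ h => h ⟨0, Nat.pos_of_ne_zero hM⟩⟩

end Respects

/-! ### Injective objects of sets with a relation -/

section Injective

variable {n : ℕ}

theorem isInternalRelation_of_surjective {m : ℕ} {R A : (RelObj.{w} n)ᵒᵖ}
    (r : Fin m → (R ⟶ A)) (hr : ∀ x : R.unop.carrier, ∃ i a, (r i).unop.toFun a = x) :
    IsInternalRelation (A := fun _ => A) r := by
  intro X x y h
  apply Quiver.Hom.unop_inj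
  apply RelObj.Hom.ext
  funext z
  obtain ⟨i, a, rfl⟩ := hr z
  exact congrFun (congrArg (fun t => RelObj.Hom.toFun (Quiver.Hom.unop t)) (h i)) a

theorem exists_eq_of_isInternalRelation {m : ℕ} {R A : (RelObj.{w} n)ᵒᵖ}
    {r : Fin m → (R ⟶ A)} (hr : IsInternalRelation (A := fun _ => A) r)
    (x : R.unop.carrier) : ∃ i a, (r i).unop.toFun a = x := by
  classical
  by_contra hx
  push Not at hx
  let B : RelObj.{w} n := ⟨ULift Bool, Set.univ⟩
  let f : R.unop ⟶ B := ⟨fun _ => ⟨true⟩, fun _ _ => Set.mem_univ _⟩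
  let g : R.unop ⟶ B := ⟨fun z => ⟨decide (z ≠ x)⟩, fun _ _ => Set.mem_univ _⟩
  have hfg : f.op = g.op := hr f.op g.op fun i => by
    apply Quiver.Hom.unop_inj
    apply RelObj.Hom.ext
    funext a
    change (⟨true⟩ : ULift Bool) = ⟨decide ((r i).unop.toFun a ≠ x)⟩
    rw [decide_eq_true (hx i a)]
  have := congrArg ULift.down (congrFun (congrArg RelObj.Hom.toFun (Quiver.Hom.op_inj hfg)) x)
  change true = decide (x ≠ x) at this
  simp at this

theorem isClosedOver_of_respects {M : IntMatrix} {X : RelObj.{w} n} (hX : X.Respects M)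
    {R A : (RelObj.{w} n)ᵒᵖ} (r : Fin M.rows → (R ⟶ A))
    (hr : ∀ x : R.unop.carrier, ∃ i a, (r i).unop.toFun a = x) :
    IsClosedOver M r (Opposite.op X) := by
  intro f hf
  choose g hg using hf
  choose p a hpa using hr
  have hga : ∀ j i b, (f (M.entry i j)).unop.toFun b = (g j).unop.toFun ((r i).unop.toFun b) :=
    fun j i b => congrFun (congrArg (fun t => RelObj.Hom.toFun (Quiver.Hom.unop t)) (hg j i)) b
  -- Every `x` is some `r i a`, which forces its value; the first condition makes it independent of
  -- the choice, the second makes it preserve relations.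
  let v : R.unop ⟶ X := ⟨fun x => (f M.zero).unop.toFun (a x), fun t ht =>
    hX.2 (fun s => p (t s)) (fun s l => (f l).unop.toFun (a (t s))) fun j => by
      simpa only [hga, hpa] using (g j).unop.map_rel t ht⟩
  refine ⟨v.op, fun i => ?_⟩
  apply Quiver.Hom.unop_inj
  apply RelObj.Hom.ext
  funext b
  refine hX.1 i (p ((r i).unop.toFun b)) (fun l => (f l).unop.toFun b)
    (fun l => (f l).unop.toFun (a ((r i).unop.toFun b))) fun j => ?_
  rw [hga, hga, hpa]

/-- The generic test: `A` consists of all valuations, and `R` of pairs (row, valuation), identified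
when all columns agree on them. -/
theorem respects_of_injectiveObjects {S : Set IntMatrix} {Y : RelObj.{w} n}
    (hY : injectiveObjects (RelObj.{w} n) S Y) {M : IntMatrix} (hM : M ∈ S) : Y.Respects M := by
  let A : RelObj.{w} n := ⟨Fin M.bound → Y.carrier, ∅⟩
  let val : Fin M.cols → Fin M.rows × A.carrier → Y.carrier := fun j z => z.2 (M.entry z.1 j)
  let R : RelObj.{w} n := RelObj.induced (fun _ : Fin M.cols => Y) val
  let r : Fin M.rows → (A ⟶ R) := fun i =>
    ⟨fun y => Quotient.mk (kernelSetoid val) (i, y), fun _ h => h.elim⟩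
  obtain ⟨v, hv⟩ := hY M hM (fun i => (r i).op) (isInternalRelation_of_surjective _ fun x => by
      induction x using Quotient.inductionOn with
      | h z => exact ⟨z.1, z.2, rfl⟩)
    (fun l => Quiver.Hom.op (⟨fun y => y l, fun _ h => h.elim⟩ : A ⟶ Y))
    (fun j => ⟨Quiver.Hom.op (⟨kernelDesc val j, fun t ht => ht j⟩ : R ⟶ Y), fun _ => rfl⟩)
  have hv' : ∀ i (y : A.carrier), y M.zero =
      v.unop.toFun (Quotient.mk (kernelSetoid val) (i, y)) := fun i y =>
    congrFun (congrArg (fun t => RelObj.Hom.toFun (Quiver.Hom.unop t)) (hv i)) y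
  refine ⟨fun p q y z h => ?_, fun p y h => ?_⟩
  · rw [hv' p y, hv' q z]
    exact congrArg v.unop.toFun (Quotient.sound h)
  · have := v.unop.map_rel (fun s => Quotient.mk (kernelSetoid val) (p s, y s)) h
    simpa only [← hv'] using this

theorem injectiveObjects_iff {S : Set IntMatrix} {Y : RelObj.{w} n} :
    injectiveObjects (RelObj.{w} n) S Y ↔ ∀ M ∈ S, Y.Respects M :=
  ⟨fun hY _ hM => respects_of_injectiveObjects hY hM, fun hY M hM _ _ r hr =>
    isClosedOver_of_respects (hY M hM) r (exists_eq_of_isInternalRelation hr)⟩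

end Injective

/-! ### The dual of the injective objects lies in `mclex S` -/

section DualInjRel

variable {S : Set IntMatrix} {n : ℕ}

theorem InjRel.hom_ext_apply {X Y : InjRel.{w} S n} {f g : X ⟶ Y}
    (h : ∀ x, f.hom.toFun x = g.hom.toFun x) : f = g :=
  ObjectProperty.hom_ext _ (RelObj.Hom.ext (funext h))

section Colimit

variable {J : Type} [SmallCategory J] (F : J ⥤ InjRel.{w} S n)

/-- The action of a cocone on the disjoint union of the diagram. -/
def coconeVal (c : Cocone F) (z : Σ j, (F.obj j).obj.carrier) : c.pt.obj.carrier :=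
  (c.ι.app z.1).hom.toFun z.2

/-- The colimit of a diagram of injective objects: the joint image of all its cocones. -/
def colimitObj : InjRel.{w} S n :=
  -- Cocones form a large family, but a quotient of the disjoint union stays in universe `w`.
  ⟨RelObj.induced (fun c : Cocone F => c.pt.obj) (coconeVal F), injectiveObjects_iff.2 fun _ hM =>
    RelObj.Respects.induced (fun c => injectiveObjects_iff.1 c.pt.property _ hM) _⟩

/-- The colimit cocone on `colimitObj F`. -/
def colimitCocone : Cocone F where
  pt := colimitObj F
  ι :=
    { app := fun j => ObjectProperty.homMk
        ⟨fun x => Quotient.mk (kernelSetoid (coconeVal F)) ⟨j, x⟩,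
          fun t ht c => (c.ι.app j).hom.map_rel t ht⟩
      naturality := fun _ _ f => InjRel.hom_ext_apply fun x =>
        Quotient.sound (s := kernelSetoid (coconeVal F)) fun c =>
          congrArg (fun t => t.hom.toFun x) (c.w f) }

/-- The cocone `colimitCocone F` is a colimit. -/
def colimitCoconeIsColimit : IsColimit (colimitCocone F) where
  desc c := ObjectProperty.homMk ⟨kernelDesc (coconeVal F) c, fun _ ht => ht c⟩
  fac _ _ := rfl
  uniq c m hm := InjRel.hom_ext_apply fun x => by
    induction x using Quotient.inductionOn with
    | h z => exact congrArg (fun t => t.hom.toFun z.2) (hm z.1)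

end Colimit

instance : HasFiniteColimits (InjRel.{w} S n) where
  out _ _ _ := ⟨fun F => ⟨⟨colimitCocone F, colimitCoconeIsColimit F⟩⟩⟩

/-- Into an object with two points, there are enough morphisms to separate points. -/
theorem surjective_of_isInternalRelation {X : InjRel.{w} S n} {x₀ x₁ : X.obj.carrier}
    (hx : x₀ ≠ x₁) {m : ℕ} {R A : (InjRel.{w} S n)ᵒᵖ} {r : Fin m → (R ⟶ A)}
    (hr : IsInternalRelation (A := fun _ => A) r) (x : R.unop.obj.carrier) :
    ∃ i a, (r i).unop.hom.toFun a = x := by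
  classical
  by_contra hne
  push Not at hne
  -- A two-point set need not be injective, so the test object is `X` itself with the full relation.
  let B : InjRel.{w} S n := ⟨⟨X.obj.carrier, Set.univ⟩, injectiveObjects_iff.2 fun _ hM =>
    (injectiveObjects_iff.1 X.property _ hM).of_rel_eq_univ⟩
  let f : R.unop ⟶ B := ObjectProperty.homMk ⟨fun _ => x₀, fun _ _ => Set.mem_univ _⟩
  let g : R.unop ⟶ B := ObjectProperty.homMk
    ⟨fun z => if z = x then x₁ else x₀, fun _ _ => Set.mem_univ _⟩
  have hfg : f.op = g.op := hr f.op g.op fun i => by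
    apply Quiver.Hom.unop_inj
    refine InjRel.hom_ext_apply fun a => ?_
    change x₀ = if (r i).unop.hom.toFun a = x then x₁ else x₀
    rw [if_neg (hne i a)]
  have h : x₀ = if x = x then x₁ else x₀ :=
    congrArg (fun t => t.hom.toFun x) (Quiver.Hom.op_inj hfg)
  rw [if_pos rfl] at h
  exact hx h

theorem hasClosedRelations_dual_injRel (hS : ∀ M ∈ S, ¬ M.IsEmpty) {M : IntMatrix} (hM : M ∈ S) :
    HasClosedRelations (InjRel.{w} S n)ᵒᵖ M := by
  intro R A r hr X f hf
  by_cases hX : Subsingleton X.unop.obj.carrier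
  -- Any column supplies a map `R → X`; this is where nonemptiness of `M` enters.
  · obtain ⟨g, -⟩ := hf ⟨0, Nat.pos_of_ne_zero (hS M hM)⟩
    exact ⟨g, fun i => Quiver.Hom.unop_inj (InjRel.hom_ext_apply fun _ => Subsingleton.elim _ _)⟩
  · rw [not_subsingleton_iff_nontrivial] at hX
    obtain ⟨x₀, x₁, hx⟩ := hX.exists_pair_ne
    obtain ⟨v, hv⟩ := isClosedOver_of_respects (injectiveObjects_iff.1 X.unop.property M hM)
      (fun i => (r i).unop.hom.op) (surjective_of_isInternalRelation hx hr)
      (fun l => (f l).unop.hom.op) fun j => by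
        obtain ⟨g, hg⟩ := hf j
        exact ⟨g.unop.hom.op, fun i => congrArg (fun t => t.unop.hom.op) (hg i)⟩
    exact ⟨Quiver.Hom.op (ObjectProperty.homMk v.unop : R.unop ⟶ X.unop), fun i =>
      Quiver.Hom.unop_inj (ObjectProperty.hom_ext _ (congrArg Quiver.Hom.unop (hv i)))⟩

theorem dualInjRel_mem_mclex (hS : ∀ M ∈ S, ¬ M.IsEmpty) (n : ℕ) :
    dualInjRel.{w} S n ∈ mclex S :=
  ⟨inferInstanceAs (HasFiniteLimits (InjRel.{w} S n)ᵒᵖ),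
    fun _ hM => hasClosedRelations_dual_injRel hS hM⟩

end DualInjRel

/-! ### Invariance under equivalence -/

section Transfer

universe v' u'

theorem HasClosedRelations.of_equivalence {C : Type u} [Category.{v} C] {D : Type*} [Category* D]
    (e : C ≌ D) {M : IntMatrix} (hC : HasClosedRelations C M) : HasClosedRelations D M := by
  intro R A r hr X f hf
  have hr' : IsInternalRelation (A := fun _ => e.inverse.obj A) fun i => e.inverse.map (r i) := by
    intro Y x y hxy
    rw [← cancel_epi (e.unitInv.app Y)]
    obtain ⟨x', hx'⟩ := e.inverse.map_surjective (e.unitInv.app Y ≫ x)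
    obtain ⟨y', hy'⟩ := e.inverse.map_surjective (e.unitInv.app Y ≫ y)
    rw [← hx', ← hy']
    refine congrArg _ (hr x' y' fun i => e.inverse.map_injective ?_)
    rw [e.inverse.map_comp, e.inverse.map_comp, hx', hy', Category.assoc, Category.assoc, hxy]
  obtain ⟨v, hv⟩ := hC _ hr' (e.inverse.obj X) (fun l => e.inverse.map (f l)) fun j => by
    obtain ⟨g, hg⟩ := hf j
    exact ⟨e.inverse.map g, fun i => (congrArg e.inverse.map (hg i)).trans (e.inverse.map_comp _ _)⟩
  obtain ⟨v', rfl⟩ := e.inverse.map_surjective v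
  exact ⟨v', fun i => e.inverse.map_injective (by rw [e.inverse.map_comp]; exact hv i)⟩

theorem mem_mclex_of_equivalence {C : Cat.{v, u}} {D : Cat.{v', u'}} (e : C ≌ D)
    {S : Set IntMatrix} (hC : C ∈ mclex S) : D ∈ mclex S := by
  refine ⟨⟨fun J _ _ => ?_⟩, fun M hM => (hC.2 M hM).of_equivalence e⟩
  have := hC.1
  exact Adjunction.hasLimitsOfShape_of_equivalence e.inverse

end Transfer

/-! ### Hom-sets with the relation represented by an internal relation -/

section HomRel

variable {C : Type u} [Category.{v} C] {n : ℕ}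

/-- The set of morphisms from `X` to `A`, with the relation represented by `r`. -/
def homRel {R A : C} (r : Fin n → (R ⟶ A)) (X : C) : RelObj.{v} n where
  carrier := X ⟶ A
  rel := {t | ∃ g : X ⟶ R, ∀ i, t i = g ≫ r i}

theorem homRel_respects [HasFiniteLimits C] {M : IntMatrix} (hM : HasClosedRelations C M) {R A : C}
    {r : Fin n → (R ⟶ A)} (hr : IsInternalRelation (A := fun _ => A) r) (X : C) :
    (homRel r X).Respects M := by
  refine ⟨fun p q (y z : Fin M.bound → (X ⟶ A)) h => ?_,
    fun p (y : Fin n → Fin M.bound → (X ⟶ A)) h => ?_⟩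
  -- `M`-closedness is applied to the subobject of `(A ⨯ A)^rows` where the first coordinate at `p`
  -- equals the second at `q`.
  · let P : C := ∏ᶜ fun _ : Fin M.rows => A ⨯ A
    let α : P ⟶ A := Pi.π (fun _ : Fin M.rows => A ⨯ A) p ≫ prod.fst
    let β : P ⟶ A := Pi.π (fun _ : Fin M.rows => A ⨯ A) q ≫ prod.snd
    obtain ⟨g, hg⟩ := hM (fun i => equalizer.ι α β ≫ Pi.π (fun _ : Fin M.rows => A ⨯ A) i)
      (fun Y x x' hx => by
        apply equalizer.hom_ext
        apply Pi.hom_ext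
        simpa using hx)
      X (fun l => prod.lift (y l) (z l)) fun j =>
        ⟨equalizer.lift (Pi.lift fun i => prod.lift (y (M.entry i j)) (z (M.entry i j)))
          (by simpa [α, β, prod.lift_fst, prod.lift_snd] using
            show (y (M.entry p j) : X ⟶ A) = z (M.entry q j) from h j), fun i => by simp⟩
    have hp : y M.zero = g ≫ equalizer.ι α β ≫ α := by
      simpa [α, prod.lift_fst] using congrArg (· ≫ prod.fst) (hg p)
    have hq : z M.zero = g ≫ equalizer.ι α β ≫ β := by
      simpa [β, prod.lift_snd] using congrArg (· ≫ prod.snd) (hg q)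
    rw [hp, hq, equalizer.condition]
  -- Now the relation on `A^n` is the pullback of `r` along the map taking the `s`-th coordinate of
  -- row `p s`.
  · let B : C := ∏ᶜ fun _ : Fin n => A
    let P : C := ∏ᶜ fun _ : Fin M.rows => B
    let α : P ⟶ B := Pi.lift fun s => Pi.π (fun _ : Fin M.rows => B) (p s) ≫ Pi.π _ s
    have hfst : ∀ s, pullback.snd α (Pi.lift r) ≫ r s =
        pullback.fst α (Pi.lift r) ≫ Pi.π (fun _ : Fin M.rows => B) (p s) ≫ Pi.π _ s := by
      intro s
      simpa [α] using (congrArg (· ≫ Pi.π (fun _ : Fin n => A) s)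
        (pullback.condition (f := α) (g := Pi.lift r))).symm
    choose g hg using h
    obtain ⟨v, hv⟩ := hM
      (fun i => pullback.fst α (Pi.lift r) ≫ Pi.π (fun _ : Fin M.rows => B) i)
      (fun Y x x' hx => by
        have h₁ : x ≫ pullback.fst α (Pi.lift r) = x' ≫ pullback.fst α (Pi.lift r) := by
          apply Pi.hom_ext
          simpa using hx
        refine pullback.hom_ext h₁ (hr _ _ fun s => ?_)
        rw [Category.assoc, Category.assoc, hfst, reassoc_of% h₁])
      X (fun l => Pi.lift fun s => y s l) fun j =>
        ⟨pullback.lift (Pi.lift fun i => Pi.lift fun s => y s (M.entry i j)) (g j) (by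
          apply Pi.hom_ext
          intro s
          simpa [α] using hg j s),
          fun i => by rw [pullback.lift_fst_assoc, Pi.lift_π]⟩
    refine ⟨v ≫ pullback.snd α (Pi.lift r), fun s => ?_⟩
    rw [Category.assoc, hfst]
    simpa using congrArg (· ≫ Pi.π (fun _ : Fin n => A) s) (hv (p s))

end HomRel

/-! ### Reduction to the dual of the injective objects -/

section Reduction

/-- An object that respects `S` inherits `N`-closedness of its relation from that of the relations
in the dual of the category of `S`-injective objects, even in a larger universe. -/
theorem RelObj.Respects.zero_mem_rel {S : Set IntMatrix} (hS : ∀ M ∈ S, ¬ M.IsEmpty)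
    {N : IntMatrix} (hN : HasClosedRelations (InjRel.{w} S N.rows)ᵒᵖ N) {Y : RelObj.{v} N.rows}
    (hY : ∀ M ∈ S, Y.Respects M) (f : Fin N.bound → Y.carrier)
    (hf : ∀ j, (fun i => f (N.entry i j)) ∈ Y.rel) : (fun _ => f N.zero) ∈ Y.rel := by
  let val : Unit → ULift.{w} (Fin N.bound) → Y.carrier := fun _ l => f l.down
  -- The image of `f`, a quotient of the finite set `Fin N.bound`, exists in universe `w` whatever
  -- the universe of `Y`.
  let X : InjRel.{w} S N.rows := ⟨RelObj.induced (fun _ => Y) val,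
    injectiveObjects_iff.2 fun M hM => RelObj.Respects.induced (fun _ => hY M hM) _⟩
  let row : Fin N.cols → ULift.{w} (Fin N.rows) → X.obj.carrier := fun j i =>
    Quotient.mk (kernelSetoid val) ⟨N.entry i.down j⟩
  let R : InjRel.{w} S N.rows := ⟨RelObj.induced (fun _ => X.obj) row,
    injectiveObjects_iff.2 fun M hM =>
      RelObj.Respects.induced (fun _ => injectiveObjects_iff.1 X.property M hM) _⟩
  let A : InjRel.{w} S N.rows := ⟨⟨PUnit, ∅⟩,
    injectiveObjects_iff.2 fun M hM => RelObj.respects_point (hS M hM)⟩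
  let r : Fin N.rows → (A ⟶ R) := fun i => ObjectProperty.homMk
    ⟨fun _ => Quotient.mk (kernelSetoid row) ⟨i⟩, fun _ h => h.elim⟩
  obtain ⟨v, hv⟩ := hN (fun i => (r i).op)
    (fun Z x y hxy => Quiver.Hom.unop_inj (InjRel.hom_ext_apply fun z => by
      induction z using Quotient.inductionOn with
      | h i => exact congrArg (fun t => t.unop.hom.toFun PUnit.unit) (hxy i.down)))
    (Opposite.op X)
    (fun l => Quiver.Hom.op (ObjectProperty.homMk
      ⟨fun _ => Quotient.mk (kernelSetoid val) ⟨l⟩, fun _ h => h.elim⟩ : A ⟶ X))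
    fun j => ⟨Quiver.Hom.op (ObjectProperty.homMk
      ⟨kernelDesc row j, fun t ht => ht j⟩ : R ⟶ X), fun _ => rfl⟩
  have hv' : ∀ i, v.unop.hom.toFun (Quotient.mk (kernelSetoid row) ⟨i⟩) =
      Quotient.mk (kernelSetoid val) ⟨N.zero⟩ := fun i =>
    (congrArg (fun t => t.unop.hom.toFun PUnit.unit) (hv i)).symm
  -- By `hf`, the tuple of all rows is related in `R`; `v` sends it to the constant tuple at `f
  -- N.zero`.
  have h := v.unop.hom.map_rel (fun i => Quotient.mk (kernelSetoid row) ⟨i⟩) fun j _ => hf j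
  simp only [hv'] at h
  exact h ()

theorem mclex_subset_of_hasClosedRelations {S : Set IntMatrix} (hS : ∀ M ∈ S, ¬ M.IsEmpty)
    {N : IntMatrix} (hN : HasClosedRelations (InjRel.{w} S N.rows)ᵒᵖ N) :
    mclex.{v, u} S ⊆ mclex {N} := by
  rintro C ⟨hC, hCS⟩
  refine ⟨hC, ?_⟩
  rintro _ rfl R A r hr X f hf
  exact RelObj.Respects.zero_mem_rel hS hN (Y := homRel r X)
    (fun M hM => homRel_respects (hCS M hM) hr X) f hf

end Reduction

end MatrixClass

theorem mainTheorem3 (S : Set MatrixClass.IntMatrix) (hS : ∀ M ∈ S, ¬ M.IsEmpty)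
    (N : MatrixClass.IntMatrix) :
    MatrixClass.dualInjRel.{w} S N.rows ∈ MatrixClass.mclex S ∧
      (MatrixClass.mclex.{max v w, max u (w + 1)} S ⊆ MatrixClass.mclex {N} ↔
        MatrixClass.dualInjRel.{w} S N.rows ∈ MatrixClass.mclex {N}) := by
  have hmem := MatrixClass.dualInjRel_mem_mclex.{w} hS N.rows
  refine ⟨hmem, fun h => ?_, fun h =>
    MatrixClass.mclex_subset_of_hasClosedRelations.{w} hS (h.2 N rfl)⟩
  -- Statement 1 concerns possibly larger universes, so membership passes to a lifted copy and back.
  let _ := uliftCategory.{w, w + 1, u} (MatrixClass.dualInjRel.{w} S N.rows)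
  let e := ULiftHomULiftCategory.equiv.{v, u, w, w + 1} (MatrixClass.dualInjRel.{w} S N.rows)
  let D : Cat.{max v w, max u (w + 1)} :=
    Cat.of (ULiftHom.{v} (ULift.{u} (MatrixClass.dualInjRel.{w} S N.rows)))
  exact MatrixClass.mem_mclex_of_equivalence (C := D) e.symm
    (h (MatrixClass.mem_mclex_of_equivalence (D := D) e hmem))
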